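/- \textbf{Setting.} Let $k\ge 1$ and $n\ge 1$. A \emph{$k$-Stirling permutation of order $n$} is an arrangement $\sigma=\sigma_1\sigma_2\cdots\sigma_{kn}$ of the multiset $\{1^k,2^k,\ldots,n^k\}$ such that $\sigma_s\ge\sigma_i$ whenever $i<s<j$ and $\sigma_i=\sigma_j$; let $\mathcal{Q}_n(k)$ be the set of all of them. Put $\sigma_0=\sigma_{kn+1}=0$. An index $i\in\{0,1,\ldots,kn\}$ is an \emph{ascent}, a \emph{descent} or a \emph{plateau} of $\sigma$ if $\sigma_i<\sigma_{i+1}$, $\sigma_i>\sigma_{i+1}$ or $\sigma_i=\sigma_{i+1}$, respectively; a plateau $i$ is a \emph{$j$-plateau} if there are exactly $j-1$ indices $1\le\ell<i$ with $\sigma_\ell=\sigma_i$. Let $\operatorname{asc}(\sigma)$, $\operatorname{des}(\sigma)$ and $\operatorname{plat}_j(\sigma)$ be the numbers of ascents, descents and $j$-plateaux of $\sigma$. The \emph{multivariate $k$-th order Eulerian polynomial} is $$C_n(x_1,\ldots,x_{k+1})=\sum_{\sigma\in\mathcal{Q}_n(k)}x_1^{\operatorname{plat}_1(\sigma)}x_2^{\operatorname{plat}_2(\sigma)}\cdots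 x_{k-1}^{\operatorname{plat}_{k-1}(\sigma)}\,x_k^{\operatorname{des}(\sigma)}\,x_{k+1}^{\operatorname{asc}(\sigma)}.$$ Let $e_m$ denote the $m$-th elementary symmetric polynomial in $x_1,\ldots,x_{k+1}$, with $e_0=1$. An \emph{increasing plane tree on $[n]$} is a tree with vertex set $[n]=\{1,\ldots,n\}$, rooted at $1$, such that the labels increase along every path from the root and the children of each vertex are linearly ordered. The \emph{degree} of a vertex is the number of its children, and a \emph{$0$-$1$-$\cdots$-$d$ increasing plane tree} is one in which every vertex has degree at most $d$. \textbf{Theorem.} Let $n\ge 2$. There are nonnegative integers $\gamma(n;i_1,\ldots,i_n)$, depending only on $n$ and $i_1,\ldots,i_n$, such that for every integer $k\ge 1$ with $k\ge n-2$ $$C_n(x_1,\ldots,x_{k+1})=\sum\gamma(n;i_1,i_2,\ldots,i_n)\,e_{k-n+2}^{\,i_n}\,e_{k-n+3}^{\,i_{n-1}}\cdots e_k^{\,i_2}\,e_{k+1}^{\,i_1},$$ where the sum is over all sequences $(i_1,\ldots,i_n)$ of nonnegative integers such that $i_1+i_2+\cdots+i_n=n$, $1\le i_1\le n-1$, $i_n\in\{0,1\}$,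 and $i_1=n-1$ if $i_n=1$. Moreover, for each such sequence and each such $k$, $\gamma(n;i_1,\ldots,i_n)$ is the number of $0$-$1$-$\cdots$-$(k+1)$ increasing plane trees on $[n]$ that have exactly $i_j$ vertices of degree $j-1$ for all $1\le j\le n$. -/

import Mathlib

/-! ### `k`-Stirling permutations and their statistics -/

/-- A word `σ = σ₁ σ₂ ⋯ σ_m` has the Stirling property if `σ_s ≥ σ_i` whenever `σ_i = σ_j` and
`i < s < j`. -/
def HasStirlingProperty (σ : List ℕ) : Prop :=
  ∀ i s j : Fin σ.length, i < s → s < j → σ.get i = σ.get j → σ.get i ≤ σ.get s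

instance (σ : List ℕ) : Decidable (HasStirlingProperty σ) := by
  unfold HasStirlingProperty; infer_instance

/-- The set `𝒬_n(k)` of `k`-Stirling permutations of order `n`: the arrangements of the multiset
`{1^k, 2^k, …, n^k}` that have the Stirling property. -/
def stirlingPermutations (k n : ℕ) : Finset (List ℕ) :=
  (k • (Finset.Icc 1 n).val).lists.toFinset.filter HasStirlingProperty

/-- The `i`-th entry `σ_i` of a word `σ = σ₁ ⋯ σ_m`, with the convention `σ₀ = σ_{m+1} = 0`. -/
def entry (σ : List ℕ) (i : ℕ) : ℕ := (0 :: σ).getD i 0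

/-- The number of ascents: indices `0 ≤ i ≤ m` with `σ_i < σ_{i+1}`. -/
def asc (σ : List ℕ) : ℕ :=
  ((Finset.range (σ.length + 1)).filter fun i => entry σ i < entry σ (i + 1)).card

/-- The number of descents: indices `0 ≤ i ≤ m` with `σ_i > σ_{i+1}`. -/
def des (σ : List ℕ) : ℕ :=
  ((Finset.range (σ.length + 1)).filter fun i => entry σ (i + 1) < entry σ i).card

/-- The number of `j`-plateaux (`j ≥ 1`): indices `i` with `σ_i = σ_{i+1}` such that there are
exactly `j - 1` indices `1 ≤ ℓ < i` with `σ_ℓ = σ_i`. -/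
def plat (j : ℕ) (σ : List ℕ) : ℕ :=
  ((Finset.range (σ.length + 1)).filter fun i =>
    entry σ i = entry σ (i + 1) ∧
      ((Finset.Ico 1 i).filter fun l => entry σ l = entry σ i).card + 1 = j).card

/-- The exponent of the variable `x_j`, `1 ≤ j ≤ k + 1`, in the weight of `σ`:
`plat_j(σ)` for `j ≤ k - 1`, `des(σ)` for `j = k`, and `asc(σ)` for `j = k + 1`. -/
def weightExponent (k : ℕ) (σ : List ℕ) (j : ℕ) : ℕ :=
  if j = k + 1 then asc σ else if j = k then des σ else plat j σ

/-- The multivariate `k`-th order Eulerian polynomial `C_n(x_1, …, x_{k+1})`.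
The variable `x_{j+1}` is `MvPolynomial.X j` with `j : Fin (k + 1)`. -/
noncomputable def eulerianPoly (k n : ℕ) : MvPolynomial (Fin (k + 1)) ℤ :=
  ∑ σ ∈ stirlingPermutations k n,
    ∏ j : Fin (k + 1), MvPolynomial.X j ^ weightExponent k σ ((j : ℕ) + 1)

/-! ### Increasing plane trees -/

/-- An increasing plane tree on `[n]` (with `n ≥ 1`). The element `v : Fin n` is the vertex with
label `v + 1`; the root is the vertex labelled `1`. The tree is given by the linearly ordered list
of children of each vertex: children carry larger labels than their parent, and every vertex other
than the root occurs exactly once as a child. (So the parent of each vertex other than the root is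
well defined, and going from a vertex to its parent repeatedly leads to the root.) -/
@[ext]
structure IncreasingPlaneTree (n : ℕ) where
  /-- The children of a vertex, from left to right. -/
  children : Fin n → List (Fin n)
  lt_of_mem : ∀ v, ∀ u ∈ children v, v < u
  count_eq_one : ∀ u : Fin n, (u : ℕ) ≠ 0 → ∑ v, (children v).count u = 1

namespace IncreasingPlaneTree

/-- The degree of a vertex is the number of its children. -/
def degree {n : ℕ} (T : IncreasingPlaneTree n) (v : Fin n) : ℕ := (T.children v).length

theorem children_nodup {n : ℕ} (T : IncreasingPlaneTree n) (v : Fin n) :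
    (T.children v).Nodup := by
  rw [List.nodup_iff_count_le_one]
  intro u
  by_cases hu : (u : ℕ) = 0
  · have h : u ∉ T.children v := fun hm => by
      have := T.lt_of_mem v u hm
      rw [Fin.lt_def] at this
      omega
    rw [List.count_eq_zero_of_not_mem h]
    exact Nat.zero_le _
  · rw [← T.count_eq_one u hu]
    exact Finset.single_le_sum (f := fun w => (T.children w).count u)
      (fun _ _ => Nat.zero_le _) (Finset.mem_univ v)

/-- There are finitely many increasing plane trees on `[n]`, so counting them with `Nat.card` is
meaningful. -/
instance finite (n : ℕ) : Finite (IncreasingPlaneTree n) := by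
  refine Finite.of_injective
    (fun (T : IncreasingPlaneTree n) (v : Fin n) =>
      (⟨T.children v, T.children_nodup v⟩ : {l : List (Fin n) // l.Nodup})) ?_
  intro T T' h
  ext1
  funext v
  exact congrArg Subtype.val (congrFun h v)

end IncreasingPlaneTree

/-- The number of 0-1-⋯-d increasing plane trees on `[n]` (every vertex has at most `d` children)
with exactly `i_j` vertices of degree `j - 1` for all `1 ≤ j ≤ n`. The number `i_{j+1}` is `i j`
with `j : Fin n`. -/
noncomputable def treeCount (d n : ℕ) (i : Fin n → ℕ) : ℕ :=
  Nat.card {T : IncreasingPlaneTree n //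
    (∀ v, T.degree v ≤ d) ∧
      ∀ j : Fin n, (Finset.univ.filter fun v => T.degree v = (j : ℕ)).card = i j}

/-- The sequences `(i_1, …, i_n)` of nonnegative integers with `i_1 + ⋯ + i_n = n`,
`1 ≤ i_1 ≤ n - 1`, `i_n = 0` or `i_n = 1`, and `i_1 = n - 1` in case `i_n = 1`.
The number `i_{j+1}` is `i j` with `j : Fin n`. -/
def indexSequences (n : ℕ) (hn : 2 ≤ n) : Finset (Fin n → ℕ) :=
  (Finset.piAntidiag Finset.univ n).filter fun i =>
    (1 ≤ i ⟨0, by omega⟩ ∧ i ⟨0, by omega⟩ ≤ n - 1) ∧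
    (i ⟨n - 1, by omega⟩ = 0 ∨ i ⟨n - 1, by omega⟩ = 1) ∧
    (i ⟨n - 1, by omega⟩ = 1 → i ⟨0, by omega⟩ = n - 1)

/-! ### The derivation `∑ ∂/∂x_j` -/

/-! Both sides obey the same recursion. Let `D = ∑ ∂/∂x_j` and `y_j = e_{k+1-j}`, so that `y_0 = x_1
⋯ x_{k+1}`.

Words: a Stirling permutation of order `n + 1` arises uniquely from one of order `n` by inserting
the `k` copies of `n + 1` as one block into a gap. The variable marking that gap disappears, and the
`k + 1` new gaps carry each variable once (one ascent, one descent, one `j`-plateau for each `j <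
k`). Summing over the gaps gives `C_{n+1} = y_0 · D C_n` (`eulerianPoly_succ`).

Trees: give a vertex of degree `j` the weight `y_j`. A tree on `[n+1]` arises uniquely from one on
`[n]` by hanging a new leaf on a vertex of degree `j` in one of `j + 1` positions, which turns `y_j`
into `y_{j+1}` and adds a factor `y_0`. As `D y_j = (j+1) y_{j+1}` (`sumPartials_coesymm`), the tree
polynomial also satisfies `P_{n+1} = y_0 · D P_n` (`genPoly_succ`).

Both recursions start at `y_0` for `n = 1`, so `C_n = P_n`. Grouping trees by degree sequence gives
the expansion. All degrees are at most `n - 1 ≤ k + 1`, so the coefficients do not depend on `k`. -/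

theorem derivation_map_prod {A R ι : Type*} [CommRing A] [CommRing R] [Algebra A R]
    [DecidableEq ι] (D : Derivation A R R)
    (s : Finset ι) (f : ι → R) :
    D (∏ i ∈ s, f i) = ∑ i ∈ s, (∏ j ∈ s.erase i, f j) * D (f i) := by
  induction s using Finset.induction_on with
  | empty => simp
  | insert a s ha ih =>
    rw [Finset.prod_insert ha, Derivation.leibniz, ih, Finset.sum_insert ha,
      Finset.erase_insert ha, smul_eq_mul, smul_eq_mul, add_comm, Finset.mul_sum]
    congr 1
    refine Finset.sum_congr rfl fun i hi => ?_
    have hne : a ≠ i := fun h => ha (h ▸ hi)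
    rw [Finset.erase_insert_of_ne hne, Finset.prod_insert (by simp [ha]), mul_assoc]

/-- The sum of all partial derivatives. -/
noncomputable def sumPartials (σ : Type*) : Derivation ℤ (MvPolynomial σ ℤ) (MvPolynomial σ ℤ) :=
  MvPolynomial.mkDerivation ℤ fun _ => 1

@[simp] theorem sumPartials_X {σ : Type*} (i : σ) : sumPartials σ (MvPolynomial.X i) = 1 :=
  MvPolynomial.mkDerivation_X ℤ _ i

/-- Pairs of an `(m+1)`-set and an element of it correspond to pairs of an `m`-set and an element
outside it; each `m`-set has `card σ - m` such elements. -/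
theorem sumPartials_esymm_succ (σ : Type*) [Fintype σ] [DecidableEq σ] (m : ℕ) :
    sumPartials σ (MvPolynomial.esymm σ ℤ (m + 1)) =
      ((Fintype.card σ - m : ℕ) : MvPolynomial σ ℤ) * MvPolynomial.esymm σ ℤ m := by
  have h1 : sumPartials σ (MvPolynomial.esymm σ ℤ (m + 1)) =
      ∑ t ∈ Finset.powersetCard (m + 1) Finset.univ, ∑ i ∈ t,
        ∏ j ∈ t.erase i, (MvPolynomial.X j : MvPolynomial σ ℤ) := by
    rw [MvPolynomial.esymm, map_sum]
    refine Finset.sum_congr rfl fun t _ => ?_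
    rw [derivation_map_prod]
    simp
  have h2 : ((Fintype.card σ - m : ℕ) : MvPolynomial σ ℤ) * MvPolynomial.esymm σ ℤ m =
      ∑ s ∈ Finset.powersetCard m Finset.univ, ∑ _i ∈ sᶜ,
        ∏ j ∈ s, (MvPolynomial.X j : MvPolynomial σ ℤ) := by
    rw [MvPolynomial.esymm, Finset.mul_sum]
    refine Finset.sum_congr rfl fun s hs => ?_
    rw [Finset.sum_const, Finset.card_compl, (Finset.mem_powersetCard.1 hs).2, nsmul_eq_mul]
  rw [h1, h2, Finset.sum_sigma', Finset.sum_sigma']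
  refine Finset.sum_bij' (fun x _ => ⟨x.1.erase x.2, x.2⟩) (fun x _ => ⟨insert x.2 x.1, x.2⟩)
    ?_ ?_ ?_ ?_ ?_
  · rintro ⟨t, i⟩ h
    simp only [Finset.mem_sigma, Finset.mem_powersetCard_univ] at h ⊢
    simp [Finset.card_erase_of_mem h.2, h.1]
  · rintro ⟨s, i⟩ h
    simp only [Finset.mem_sigma, Finset.mem_powersetCard_univ, Finset.mem_compl] at h ⊢
    simp [Finset.card_insert_of_notMem h.2, h.1]
  · rintro ⟨t, i⟩ h
    simp only [Finset.mem_sigma] at h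
    simp [Finset.insert_erase h.2]
  · rintro ⟨s, i⟩ h
    simp only [Finset.mem_sigma, Finset.mem_compl] at h
    simp [Finset.erase_insert h.2]
  · intros
    rfl

/-- The elementary symmetric polynomial `e_{k+1-j}` in `k + 1` variables, which is `0` for
`j > k + 1`. -/
noncomputable def coesymm (k j : ℕ) : MvPolynomial (Fin (k + 1)) ℤ :=
  if j ≤ k + 1 then MvPolynomial.esymm (Fin (k + 1)) ℤ (k + 1 - j) else 0

/-- Counting the index down from `k + 1` makes the factor `j + 1` independent of `k`, as the tree
recursion requires. At `j = k + 1` the polynomial is the constant `e_0 = 1`, whose derivative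
matches the value `0` beyond the range. -/
theorem sumPartials_coesymm (k j : ℕ) :
    sumPartials (Fin (k + 1)) (coesymm k j) = (j + 1) * coesymm k (j + 1) := by
  unfold coesymm
  rcases lt_trichotomy j (k + 1) with h | rfl | h
  · obtain ⟨m, rfl⟩ : ∃ m, k = j + m := ⟨k - j, by omega⟩
    rw [if_pos (by omega), if_pos (by omega), show j + m + 1 - j = m + 1 by omega,
      show j + m + 1 - (j + 1) = m by omega, sumPartials_esymm_succ, Fintype.card_fin,
      show j + m + 1 - m = j + 1 by omega]
    push_cast
    rfl
  · simp
  · rw [if_neg (by omega), if_neg (by omega)]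
    simp

theorem coesymm_zero (k : ℕ) : coesymm k 0 = ∏ j : Fin (k + 1), MvPolynomial.X j := by
  have h : Finset.powersetCard (k + 1) (Finset.univ : Finset (Fin (k + 1))) = {Finset.univ} := by
    convert Finset.powersetCard_self (Finset.univ : Finset (Fin (k + 1)))
    simp
  rw [coesymm, if_pos (Nat.zero_le _), MvPolynomial.esymm, Nat.sub_zero, h, Finset.sum_singleton]

/-! ### Inserting the largest vertex into an increasing plane tree -/

namespace IncreasingPlaneTree

noncomputable instance (n : ℕ) : Fintype (IncreasingPlaneTree n) := Fintype.ofFinite _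

/-- Attach the new largest vertex to `v`, to the right of its first `i` children. -/
def insertLast {n : ℕ} (T : IncreasingPlaneTree n) (v : Fin n) (i : ℕ) :
    IncreasingPlaneTree (n + 1) where
  children := Fin.lastCases [] fun w =>
    if w = v then
      ((T.children w).take i).map Fin.castSucc ++
        Fin.last n :: ((T.children w).drop i).map Fin.castSucc
    else (T.children w).map Fin.castSucc
  lt_of_mem := by
    intro w u
    induction w using Fin.lastCases with
    | last => simp
    | cast w =>
      have key : ∀ l : List (Fin n), (∀ a ∈ l, a ∈ T.children w) →
          u ∈ l.map Fin.castSucc → w.castSucc < u := by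
        intro l hl hu
        obtain ⟨a, ha, rfl⟩ := List.mem_map.1 hu
        exact Fin.castSucc_lt_castSucc_iff.2 (T.lt_of_mem w a (hl a ha))
      rw [Fin.lastCases_castSucc]
      split_ifs
      · intro hu
        rcases List.mem_append.1 hu with hu | hu
        · exact key _ (fun a ha => List.mem_of_mem_take ha) hu
        · rcases List.mem_cons.1 hu with rfl | hu
          · exact Fin.castSucc_lt_last w
          · exact key _ (fun a ha => List.mem_of_mem_drop ha) hu
      · exact key _ fun a ha => ha
  count_eq_one := by
    have hinj : Function.Injective (Fin.castSucc (n := n)) := Fin.castSucc_injective n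
    have hlast : ∀ l : List (Fin n), (l.map Fin.castSucc).count (Fin.last n) = 0 := by
      intro l
      apply List.count_eq_zero_of_not_mem
      simp
    intro u hu
    rw [Fin.sum_univ_castSucc]
    induction u using Fin.lastCases with
    | last =>
      simp only [Fin.lastCases_castSucc, Fin.lastCases_last, List.count_nil, add_zero]
      rw [Finset.sum_eq_single v]
      · simp [hlast, -List.map_take, -List.map_drop]
      · intro w _ hw
        simp [hw, hlast]
      · simp
    | cast u =>
      refine Eq.trans ?_ (T.count_eq_one u (by simpa using hu))
      simp only [Fin.lastCases_castSucc, Fin.lastCases_last, List.count_nil, add_zero]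
      refine Finset.sum_congr rfl fun w _ => ?_
      split_ifs
      · have hne : Fin.last n ≠ u.castSucc := (Fin.castSucc_lt_last u).ne'
        rw [List.count_append, List.count_cons_of_ne hne,
          List.count_map_of_injective _ _ hinj, List.count_map_of_injective _ _ hinj,
          ← List.count_append, List.take_append_drop]
      · exact List.count_map_of_injective _ _ hinj u

@[simp] theorem children_insertLast_last {n : ℕ} (T : IncreasingPlaneTree n) (v : Fin n) (i : ℕ) :
    (T.insertLast v i).children (Fin.last n) = [] := by
  simp [insertLast]

theorem children_insertLast_castSucc {n : ℕ} (T : IncreasingPlaneTree n) (v : Fin n) (i : ℕ)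
    (w : Fin n) :
    (T.insertLast v i).children w.castSucc =
      if w = v then
        ((T.children w).take i).map Fin.castSucc ++
          Fin.last n :: ((T.children w).drop i).map Fin.castSucc
      else (T.children w).map Fin.castSucc := by
  simp [insertLast]

theorem degree_insertLast_last {n : ℕ} (T : IncreasingPlaneTree n) (v : Fin n) (i : ℕ) :
    (T.insertLast v i).degree (Fin.last n) = 0 := by
  simp [degree]

theorem degree_insertLast_castSucc {n : ℕ} (T : IncreasingPlaneTree n) (v : Fin n) (i : ℕ)
    (w : Fin n) :
    (T.insertLast v i).degree w.castSucc = if w = v then T.degree w + 1 else T.degree w := by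
  rw [degree, children_insertLast_castSucc]
  split_ifs
  · have h : ((T.children w).take i).length + ((T.children w).drop i).length = T.degree w := by
      rw [← List.length_append, List.take_append_drop, degree]
    rw [← h]
    simp only [List.length_append, List.length_map, List.length_cons]
    omega
  · simp [degree]

/-- Forget the entry `Fin.last n` of a list. -/
def restrictList {n : ℕ} (l : List (Fin (n + 1))) : List (Fin n) :=
  l.filterMap (Fin.lastCases none some)

@[simp] theorem restrictList_map {n : ℕ} (l : List (Fin n)) :
    restrictList (l.map Fin.castSucc) = l := by
  simp [restrictList, List.filterMap_map]

@[simp] theorem restrictList_append {n : ℕ} (l l' : List (Fin (n + 1))) :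
    restrictList (l ++ l') = restrictList l ++ restrictList l' := by
  simp [restrictList]

@[simp] theorem restrictList_last_cons {n : ℕ} (l : List (Fin (n + 1))) :
    restrictList (Fin.last n :: l) = restrictList l := by
  simp [restrictList]

theorem map_restrictList {n : ℕ} (l : List (Fin (n + 1))) (h : Fin.last n ∉ l) :
    (restrictList l).map Fin.castSucc = l := by
  induction l with
  | nil => rfl
  | cons a l ih =>
    induction a using Fin.lastCases with
    | last => simp at h
    | cast a =>
      have := ih fun hm => h (List.mem_cons_of_mem _ hm)
      simpa [restrictList] using this

theorem mem_restrictList {n : ℕ} (l : List (Fin (n + 1))) (a : Fin n) :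
    a ∈ restrictList l ↔ a.castSucc ∈ l := by
  rw [restrictList, List.mem_filterMap]
  constructor
  · rintro ⟨b, hb, h⟩
    induction b using Fin.lastCases with
    | last => simp at h
    | cast b =>
      simp only [Fin.lastCases_castSucc, Option.some.injEq] at h
      exact h ▸ hb
  · intro h
    exact ⟨_, h, by simp⟩

theorem count_restrictList {n : ℕ} (l : List (Fin (n + 1))) (a : Fin n) :
    (restrictList l).count a = l.count a.castSucc := by
  induction l with
  | nil => rfl
  | cons b l ih =>
    induction b using Fin.lastCases with
    | last => rw [restrictList_last_cons, ih, List.count_cons_of_ne (Fin.castSucc_lt_last a).ne']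
    | cast b =>
      have h : restrictList (b.castSucc :: l) = b :: restrictList l := by simp [restrictList]
      rw [h, List.count_cons, List.count_cons, ih]
      simp

theorem children_last {n : ℕ} (T : IncreasingPlaneTree (n + 1)) :
    T.children (Fin.last n) = [] :=
  List.eq_nil_iff_forall_not_mem.2 fun u hu =>
    absurd (T.lt_of_mem _ u hu) (not_lt.2 (Fin.le_last u))

/-- Delete the largest vertex. -/
def removeLast {n : ℕ} (T : IncreasingPlaneTree (n + 1)) : IncreasingPlaneTree n where
  children v := restrictList (T.children v.castSucc)
  lt_of_mem v u hu :=
    Fin.castSucc_lt_castSucc_iff.1 (T.lt_of_mem _ _ ((mem_restrictList _ _).1 hu))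
  count_eq_one u hu := by
    have h := T.count_eq_one u.castSucc (by simpa using hu)
    rw [Fin.sum_univ_castSucc, T.children_last] at h
    simpa [count_restrictList] using h

@[simp] theorem removeLast_insertLast {n : ℕ} (T : IncreasingPlaneTree n) (v : Fin n) (i : ℕ) :
    (T.insertLast v i).removeLast = T := by
  ext1
  funext w
  simp only [removeLast, children_insertLast_castSucc]
  split_ifs <;> simp [-List.map_take, -List.map_drop]

theorem eq_of_mem_children {n : ℕ} (T : IncreasingPlaneTree n) {u v w : Fin n}
    (hv : u ∈ T.children v) (hw : u ∈ T.children w) : v = w := by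
  by_contra hne
  have hu : (u : ℕ) ≠ 0 := by
    have := T.lt_of_mem v u hv
    rw [Fin.lt_def] at this
    omega
  have h := T.count_eq_one u hu
  have h2 : ∑ x ∈ ({v, w} : Finset (Fin n)), (T.children x).count u ≤
      ∑ x, (T.children x).count u :=
    Finset.sum_le_sum_of_subset (Finset.subset_univ _)
  rw [Finset.sum_pair hne, h] at h2
  have := List.count_pos_iff.2 hv
  have := List.count_pos_iff.2 hw
  omega

theorem exists_mem_children {n : ℕ} (T : IncreasingPlaneTree n) (u : Fin n) (hu : (u : ℕ) ≠ 0) :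
    ∃ v, u ∈ T.children v := by
  by_contra! h
  have h1 := T.count_eq_one u hu
  rw [Finset.sum_eq_zero fun v _ => List.count_eq_zero_of_not_mem (h v)] at h1
  exact zero_ne_one h1

/-- The largest vertex is a leaf with exactly one parent `v`; the position `i` is the number of
siblings to its left. -/
theorem exists_insertLast_eq {n : ℕ} (hn : n ≠ 0) (T : IncreasingPlaneTree (n + 1)) :
    ∃ v, ∃ i ≤ T.removeLast.degree v, T.removeLast.insertLast v i = T := by
  obtain ⟨v, hv⟩ := T.exists_mem_children (Fin.last n) (by simpa using hn)
  induction v using Fin.lastCases with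
  | last => simp [T.children_last] at hv
  | cast v =>
    obtain ⟨s, t, hst⟩ := List.append_of_mem hv
    have hnd := T.children_nodup v.castSucc
    rw [hst, List.nodup_append, List.nodup_cons] at hnd
    have hs : Fin.last n ∉ s := fun h => hnd.2.2 _ h _ (by simp) rfl
    have ht : Fin.last n ∉ t := hnd.2.1.1
    have hr : T.removeLast.children v = restrictList s ++ restrictList t := by
      simp [removeLast, hst]
    refine ⟨v, (restrictList s).length, ?_, ?_⟩
    · rw [degree, hr, List.length_append]
      exact Nat.le_add_right _ _
    · ext1
      funext w
      induction w using Fin.lastCases with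
      | last => rw [children_insertLast_last, T.children_last]
      | cast w =>
        rw [children_insertLast_castSucc]
        split_ifs with hw
        · subst hw
          rw [hr, List.take_left, List.drop_left, map_restrictList s hs, map_restrictList t ht, hst]
        · refine map_restrictList _ fun h => hw ?_
          exact Fin.castSucc_injective n (T.eq_of_mem_children h hv)

theorem last_mem_children_insertLast {n : ℕ} (T : IncreasingPlaneTree n) (v w : Fin n) (i : ℕ) :
    Fin.last n ∈ (T.insertLast v i).children w.castSucc ↔ w = v := by
  rw [children_insertLast_castSucc]
  split_ifs with h <;> simp [h]

theorem idxOf_last_children_insertLast {n : ℕ} (T : IncreasingPlaneTree n) (v : Fin n) (i : ℕ)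
    (hi : i ≤ T.degree v) :
    ((T.insertLast v i).children v.castSucc).idxOf (Fin.last n) = i := by
  rw [children_insertLast_castSucc, if_pos rfl, List.idxOf_append_of_notMem (by simp [-List.map_take])]
  rw [degree] at hi
  simpa using hi

/-- Attaching the largest vertex is a bijection: its removal returns the tree, its parent is `v`,
and its index among the children is `i`. For `n = 0` there is no vertex to attach it to. -/
theorem sum_eq_sum_insertLast {n : ℕ} (hn : n ≠ 0) {M : Type*} [AddCommMonoid M]
    (f : IncreasingPlaneTree (n + 1) → M) :
    ∑ T, f T = ∑ T : IncreasingPlaneTree n, ∑ v, ∑ i ∈ Finset.range (T.degree v + 1),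
      f (T.insertLast v i) := by
  simp_rw [Finset.sum_sigma']
  symm
  refine Finset.sum_bij (fun x _ => x.1.insertLast x.2.1 x.2.2) ?_ ?_ ?_ ?_
  · simp
  · rintro ⟨T, v, i⟩ h ⟨S, w, j⟩ h' heq
    simp only [Finset.mem_sigma, Finset.mem_univ, Finset.mem_range, true_and,
      Nat.lt_succ_iff] at h h' heq
    have hTS : T = S := by simpa using congrArg removeLast heq
    subst hTS
    have hvw : v = w := by
      rw [← T.last_mem_children_insertLast w v j, ← heq, T.last_mem_children_insertLast]
    subst hvw
    have hij : i = j := by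
      rw [← T.idxOf_last_children_insertLast v i h, heq, T.idxOf_last_children_insertLast v j h']
    subst hij
    rfl
  · intro T _
    obtain ⟨v, i, hi, h⟩ := T.exists_insertLast_eq hn
    exact ⟨⟨T.removeLast, v, i⟩, by simpa [Nat.lt_succ_iff] using hi, h⟩
  · intros
    rfl

/-! ### The tree polynomial and its recursion -/

/-- The generating polynomial of increasing plane trees: a vertex of degree `j` has weight `y j`. -/
noncomputable def genPoly {R : Type*} [CommRing R] (y : ℕ → R) (n : ℕ) : R :=
  ∑ T : IncreasingPlaneTree n, ∏ v, y (T.degree v)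

theorem prod_degree_insertLast {R : Type*} [CommRing R] (y : ℕ → R) {n : ℕ}
    (T : IncreasingPlaneTree n) (v : Fin n) (i : ℕ) :
    ∏ u, y ((T.insertLast v i).degree u) =
      y 0 * ((∏ w ∈ Finset.univ.erase v, y (T.degree w)) * y (T.degree v + 1)) := by
  rw [Fin.prod_univ_castSucc, degree_insertLast_last, mul_comm,
    ← Finset.prod_erase_mul _ _ (Finset.mem_univ v)]
  congr 2
  · refine Finset.prod_congr rfl fun w hw => ?_
    rw [degree_insertLast_castSucc, if_neg (Finset.ne_of_mem_erase hw)]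
  · rw [degree_insertLast_castSucc, if_pos rfl]

theorem genPoly_succ {A R : Type*} [CommRing A] [CommRing R] [Algebra A R] (D : Derivation A R R)
    (y : ℕ → R)
    (hy : ∀ j : ℕ, D (y j) = (j + 1) * y (j + 1)) {n : ℕ} (hn : n ≠ 0) :
    genPoly y (n + 1) = y 0 * D (genPoly y n) := by
  rw [genPoly, sum_eq_sum_insertLast hn, genPoly, map_sum, Finset.mul_sum]
  refine Finset.sum_congr rfl fun T _ => ?_
  rw [derivation_map_prod, Finset.mul_sum]
  refine Finset.sum_congr rfl fun v _ => ?_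
  simp_rw [prod_degree_insertLast, Finset.sum_const, Finset.card_range, hy, nsmul_eq_mul]
  push_cast
  ring

theorem genPoly_one {R : Type*} [CommRing R] (y : ℕ → R) : genPoly y 1 = y 0 := by
  have hc : ∀ (T : IncreasingPlaneTree 1) v, T.children v = [] := fun T v => by
    rw [Subsingleton.elim v (Fin.last 0), T.children_last]
  let T₀ : IncreasingPlaneTree 1 := ⟨fun _ => [], by simp, by simp⟩
  have hT : ∀ T, T = T₀ := fun T => by ext1; funext v; rw [hc, hc]
  have hu : (Finset.univ : Finset (IncreasingPlaneTree 1)) = {T₀} := by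
    ext T
    simp [hT T]
  rw [genPoly, hu, Finset.sum_singleton]
  simp [degree, hc]

end IncreasingPlaneTree

/-! ### Gaps of words -/

theorem entry_succ (σ : List ℕ) (i : ℕ) : entry σ (i + 1) = σ[i]?.getD 0 := by
  simp [entry]

/-- The positions `1, …, i` are the first `i` letters; `a ≠ 0` keeps the padding zeros past the end
of the word from being counted. -/
theorem card_filter_entry_eq (σ : List ℕ) (i a : ℕ) (ha : a ≠ 0) :
    ((Finset.Ico 1 (i + 1)).filter fun l => entry σ l = a).card = (σ.take i).count a := by
  induction i with
  | zero => simp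
  | succ i ih =>
    rw [← Finset.insert_Ico_right_eq_Ico_add_one (by omega), Finset.filter_insert, entry_succ,
      List.take_add_one, List.count_append, ← ih]
    rcases h : σ[i]? with _ | b
    · simp [ha.symm]
    · by_cases hb : b = a
      · simp [hb]
      · simp [hb]

theorem entry_ne_zero {σ : List ℕ} (h0 : 0 ∉ σ) {i : ℕ} (hi : i ≠ 0) (hi' : i ≤ σ.length) :
    entry σ i ≠ 0 := by
  obtain ⟨i, rfl⟩ := Nat.exists_eq_succ_of_ne_zero hi
  rw [entry_succ, List.getElem?_eq_getElem hi', Option.getD_some]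
  exact fun h => h0 (h ▸ List.getElem_mem _)

/-- The number `j` such that the gap between the entries `i` and `i + 1` is marked by the variable
`x_{j+1}`. -/
def gapType (k : ℕ) (σ : List ℕ) (i : ℕ) : ℕ :=
  if entry σ i < entry σ (i + 1) then k
  else if entry σ (i + 1) < entry σ i then k - 1
  else ((Finset.Ico 1 i).filter fun l => entry σ l = entry σ i).card

/-- The letter at a plateau occurs at `i`, at `i + 1` and at the counted earlier places, at most `k`
times in all. Hence plateau types stay below `k - 1`, apart from descents and ascents. The empty
word is excluded because its only gap is the plateau `0 = 0`. -/
theorem card_plateau_lt {σ : List ℕ} {k i : ℕ} (h0 : 0 ∉ σ) (hne : σ ≠ [])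
    (hk : ∀ a, σ.count a ≤ k) (hi : i < σ.length + 1) (h : entry σ i = entry σ (i + 1)) :
    ((Finset.Ico 1 i).filter fun l => entry σ l = entry σ i).card + 1 < k := by
  have hlen : 0 < σ.length := List.length_pos_iff.2 hne
  have hi0 : i ≠ 0 := by
    rintro rfl
    exact entry_ne_zero h0 (i := 1) one_ne_zero hlen (h.symm.trans rfl)
  have hpos : entry σ i ≠ 0 := entry_ne_zero h0 hi0 (by omega)
  have hcard := card_filter_entry_eq σ (i + 1) (entry σ i) hpos
  rw [← Finset.insert_Ico_right_eq_Ico_add_one (by omega), Finset.filter_insert, if_pos h.symm,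
    Finset.card_insert_of_notMem (by simp),
    ← Finset.insert_Ico_right_eq_Ico_add_one (by omega), Finset.filter_insert, if_pos rfl,
    Finset.card_insert_of_notMem (by simp)] at hcard
  have := (List.take_sublist (i + 1) σ).count_le (entry σ i)
  have := hk (entry σ i)
  omega

/-- The product over all gaps of the variables that mark them. -/
def wordWeight {R : Type*} [CommRing R] (x : ℕ → R) (k : ℕ) (σ : List ℕ) : R :=
  ∏ i ∈ Finset.range (σ.length + 1), x (gapType k σ i)

theorem weightExponent_succ {σ : List ℕ} {k : ℕ} (hk0 : k ≠ 0) (h0 : 0 ∉ σ) (hne : σ ≠ [])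
    (hk : ∀ a, σ.count a ≤ k) (j : ℕ) :
    weightExponent k σ (j + 1) =
      ((Finset.range (σ.length + 1)).filter fun i => gapType k σ i = j).card := by
  have hplat := fun i => card_plateau_lt (i := i) h0 hne hk
  unfold weightExponent asc des plat
  split_ifs with h1 h2
  all_goals
    congr 1
    refine Finset.filter_congr fun i hi => ?_
    have := hplat i (Finset.mem_range.1 hi)
    unfold gapType
    split_ifs <;> omega

theorem prod_pow_weightExponent {R : Type*} [CommRing R] (x : ℕ → R) {σ : List ℕ} {k : ℕ}
    (hk0 : k ≠ 0) (h0 : 0 ∉ σ) (hne : σ ≠ []) (hk : ∀ a, σ.count a ≤ k) :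
    ∏ j ∈ Finset.range (k + 1), x j ^ weightExponent k σ (j + 1) = wordWeight x k σ := by
  have hmaps : ∀ i ∈ Finset.range (σ.length + 1), gapType k σ i ∈ Finset.range (k + 1) := by
    intro i hi
    have := card_plateau_lt h0 hne hk (Finset.mem_range.1 hi)
    rw [Finset.mem_range]
    unfold gapType
    split_ifs <;> omega
  rw [wordWeight, ← Finset.prod_fiberwise_of_maps_to hmaps]
  refine Finset.prod_congr rfl fun j _ => ?_
  rw [weightExponent_succ hk0 h0 hne hk, ← Finset.prod_const]
  refine Finset.prod_congr rfl fun i hi => ?_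
  rw [(Finset.mem_filter.1 hi).2]

theorem prod_range_erase {R : Type*} [CommMonoid R] (f : ℕ → R) (p q : ℕ) :
    ∏ i ∈ (Finset.range (p + q + 1)).erase p, f i =
      (∏ i ∈ Finset.range p, f i) * ∏ r ∈ Finset.range q, f (p + 1 + r) := by
  -- Replacing the value at `p` by `1` turns the punctured product into one over an interval, which
  -- can be split.
  have h : ∏ i ∈ Finset.range (p + 1 + q), Function.update f p 1 i =
      ∏ i ∈ (Finset.range (p + 1 + q)).erase p, f i := by
    rw [← Finset.mul_prod_erase _ _ (Finset.mem_range.2 (by omega : p < p + 1 + q)),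
      Function.update_self, one_mul]
    exact Finset.prod_congr rfl fun i hi => Function.update_of_ne (Finset.ne_of_mem_erase hi) _ _
  rw [add_right_comm, ← h, Finset.prod_range_add, Finset.prod_range_succ, Function.update_self,
    mul_one]
  congr 1 <;> refine Finset.prod_congr rfl fun i hi => Function.update_of_ne ?_ _ _
  · exact (Finset.mem_range.1 hi).ne
  · omega

/-! ### Inserting a block of equal letters -/

/-- Insert `k` copies of `m` after the first `p` letters. -/
def insertBlock (k m p : ℕ) (σ : List ℕ) : List ℕ :=
  σ.take p ++ (List.replicate k m ++ σ.drop p)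

section insertBlock

variable {k m p : ℕ} {σ : List ℕ}

theorem length_insertBlock (k m p : ℕ) (σ : List ℕ) :
    (insertBlock k m p σ).length = σ.length + k := by
  simp only [insertBlock, List.length_append, List.length_take, List.length_replicate,
    List.length_drop]
  omega

theorem count_insertBlock (k m p : ℕ) (σ : List ℕ) (a : ℕ) :
    (insertBlock k m p σ).count a = σ.count a + if m = a then k else 0 := by
  have h : (σ.take p).count a + (σ.drop p).count a = σ.count a := by
    rw [← List.count_append, List.take_append_drop]
  rw [insertBlock, List.count_append, List.count_append, List.count_replicate, ← h]
  simp only [beq_iff_eq]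
  omega

theorem filter_insertBlock (k p : ℕ) (hm : m ∉ σ) :
    (insertBlock k m p σ).filter (fun a => a ≠ m) = σ := by
  have h : ∀ l : List ℕ, m ∉ l → l.filter (fun a => a ≠ m) = l := by
    intro l hl
    rw [List.filter_eq_self]
    intro a ha
    simpa using fun h : a = m => hl (h ▸ ha)
  rw [insertBlock, List.filter_append, List.filter_append,
    h _ fun h => hm (List.mem_of_mem_take h), h _ fun h => hm (List.mem_of_mem_drop h),
    List.filter_replicate]
  simp

theorem idxOf_insertBlock (hk : k ≠ 0) (hm : m ∉ σ) (hp : p ≤ σ.length) :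
    (insertBlock k m p σ).idxOf m = p := by
  obtain ⟨k, rfl⟩ := Nat.exists_eq_succ_of_ne_zero hk
  rw [insertBlock, List.idxOf_append_of_notMem fun h => hm (List.mem_of_mem_take h),
    List.replicate_succ, List.cons_append, List.idxOf_cons_self]
  simpa using hp

theorem entry_insertBlock_of_le (hp : p ≤ σ.length) {l : ℕ} (hl : l ≤ p) :
    entry (insertBlock k m p σ) l = entry σ l := by
  rcases l with _ | l
  · rfl
  · rw [entry_succ, entry_succ, insertBlock, List.getElem?_append_left (by simp; omega),
      List.getElem?_take_of_lt hl]

theorem entry_insertBlock_mid (hp : p ≤ σ.length) {l : ℕ} (hl : l < k) :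
    entry (insertBlock k m p σ) (p + l + 1) = m := by
  rw [entry_succ, insertBlock, List.getElem?_append_right (by simp),
    List.getElem?_append_left (by simp; omega), List.getElem?_replicate_of_lt (by simp; omega)]
  rfl

theorem entry_insertBlock_right (hp : p ≤ σ.length) (l : ℕ) :
    entry (insertBlock k m p σ) (p + k + l + 1) = entry σ (p + l + 1) := by
  rw [entry_succ, entry_succ, insertBlock, List.getElem?_append_right (by simp; omega),
    List.getElem?_append_right (by simp; omega), List.getElem?_drop]
  congr 2
  simp
  omega

theorem entry_lt (hm : ∀ a ∈ σ, a < m) (hm0 : 0 < m) (i : ℕ) : entry σ i < m := by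
  rcases i with _ | i
  · exact hm0
  · rw [entry_succ]
    rcases h : σ[i]? with _ | b
    · exact hm0
    · exact hm b (List.mem_of_getElem? h)

theorem gapType_insertBlock_left (hp : p ≤ σ.length) {i : ℕ} (hi : i < p) :
    gapType k (insertBlock k m p σ) i = gapType k σ i := by
  have h : ((Finset.Ico 1 i).filter fun l =>
      entry (insertBlock k m p σ) l = entry (insertBlock k m p σ) i) =
      (Finset.Ico 1 i).filter fun l => entry σ l = entry σ i := by
    refine Finset.filter_congr fun l hl => ?_
    have := (Finset.mem_Ico.1 hl).2
    rw [entry_insertBlock_of_le hp (by omega), entry_insertBlock_of_le hp (by omega)]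
  unfold gapType
  rw [h, entry_insertBlock_of_le hp hi.le, entry_insertBlock_of_le hp hi]

theorem gapType_insertBlock_first (hk : k ≠ 0) (hm : ∀ a ∈ σ, a < m) (hm0 : 0 < m)
    (hp : p ≤ σ.length) : gapType k (insertBlock k m p σ) p = k := by
  have h := entry_insertBlock_mid (k := k) (m := m) hp (l := 0) (Nat.pos_of_ne_zero hk)
  rw [gapType, entry_insertBlock_of_le hp le_rfl, if_pos]
  rw [add_zero] at h
  rw [h]
  exact entry_lt hm hm0 p

theorem gapType_insertBlock_mid (hm : ∀ a ∈ σ, a < m) (hm0 : 0 < m)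
    (hp : p ≤ σ.length) {t : ℕ} (ht : t + 1 < k) :
    gapType k (insertBlock k m p σ) (p + (t + 1)) = t := by
  have hmσ : m ∉ σ := fun h => lt_irrefl _ (hm m h)
  rw [gapType, ← add_assoc, entry_insertBlock_mid hp (by omega),
    show p + t + 1 + 1 = p + (t + 1) + 1 from rfl, entry_insertBlock_mid hp ht,
    if_neg (lt_irrefl _), if_neg (lt_irrefl _), card_filter_entry_eq _ _ _ hm0.ne', insertBlock,
    List.take_append, List.take_append, List.count_append, List.count_append]
  have h1 : ((σ.take p).take (p + t)).count m = 0 :=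
    List.count_eq_zero_of_not_mem fun h => hmσ (List.mem_of_mem_take (List.mem_of_mem_take h))
  have h2 : ∀ q, ((σ.drop p).take q).count m = 0 := fun q =>
    List.count_eq_zero_of_not_mem fun h => hmσ (List.mem_of_mem_drop (List.mem_of_mem_take h))
  rw [h1, h2, List.take_replicate, List.count_replicate_self, List.length_take]
  omega

theorem gapType_insertBlock_last (hm : ∀ a ∈ σ, a < m) (hm0 : 0 < m)
    (hp : p ≤ σ.length) (hk : k ≠ 0) :
    gapType k (insertBlock k m p σ) (p + k) = k - 1 := by
  have h1 := entry_insertBlock_mid (m := m) hp (Nat.sub_one_lt hk)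
  rw [show p + (k - 1) + 1 = p + k by omega] at h1
  have h2 := entry_insertBlock_right (k := k) (m := m) hp 0
  rw [add_zero] at h2
  have h3 := entry_lt hm hm0 (p + 0 + 1)
  rw [gapType, h1, h2, if_neg h3.not_gt, if_pos h3]

/-- The letters of the block differ from the letter at this gap, so its number of earlier
occurrences is unchanged. -/
theorem gapType_insertBlock_right (hm : ∀ a ∈ σ, a < m) (h0 : 0 ∉ σ) {r : ℕ}
    (hr : p + r + 1 ≤ σ.length) :
    gapType k (insertBlock k m p σ) (p + k + r + 1) = gapType k σ (p + r + 1) := by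
  have hp : p ≤ σ.length := by omega
  have hpos : entry σ (p + r + 1) ≠ 0 := entry_ne_zero h0 (by omega) hr
  have hlt : entry σ (p + r + 1) ≠ m := by
    rw [entry_succ, List.getElem?_eq_getElem hr]
    exact (hm _ (List.getElem_mem _)).ne
  have hcount : ((insertBlock k m p σ).take (p + k + r)).count (entry σ (p + r + 1)) =
      (σ.take (p + r)).count (entry σ (p + r + 1)) := by
    have hs : σ.take (p + r) = σ.take p ++ (σ.drop p).take r := by rw [List.take_add]
    rw [insertBlock, List.take_append, List.take_append, hs, List.count_append, List.count_append,
      List.count_append, List.take_of_length_le (by simp; omega), List.take_replicate,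
      List.count_replicate, if_neg (by simpa using hlt.symm), zero_add]
    congr 3
    simp
    omega
  unfold gapType
  rw [entry_insertBlock_right hp, show p + k + r + 1 + 1 = p + k + (r + 1) + 1 from rfl,
    entry_insertBlock_right hp, card_filter_entry_eq _ _ _ hpos, card_filter_entry_eq _ _ _ hpos,
    hcount]
  rfl

/-- The gaps of the block have the types `k, 0, 1, …, k - 2, k - 1` from left to right, each type
once; all old gaps except `p` keep their type. -/
theorem wordWeight_insertBlock {R : Type*} [CommRing R] (x : ℕ → R) (hk : k ≠ 0)
    (hm : ∀ a ∈ σ, a < m) (h0 : 0 ∉ σ) (hm0 : 0 < m) (hp : p ≤ σ.length) :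
    wordWeight x k (insertBlock k m p σ) = (∏ j ∈ Finset.range (k + 1), x j) *
      ∏ i ∈ (Finset.range (σ.length + 1)).erase p, x (gapType k σ i) := by
  obtain ⟨q, hq⟩ := Nat.exists_eq_add_of_le hp
  have herase : ∏ i ∈ (Finset.range (σ.length + 1)).erase p, x (gapType k σ i) =
      (∏ i ∈ Finset.range p, x (gapType k σ i)) *
        ∏ r ∈ Finset.range q, x (gapType k σ (p + r + 1)) := by
    rw [hq, prod_range_erase fun i => x (gapType k σ i)]
    simp only [add_right_comm p _ 1]
  have hmid : ∏ i ∈ Finset.range (k + 1), x (gapType k (insertBlock k m p σ) (p + i)) =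
      ∏ j ∈ Finset.range (k + 1), x j := by
    rw [Finset.prod_range_succ, Finset.prod_range_succ, gapType_insertBlock_last hm hm0 hp hk]
    obtain ⟨k, rfl⟩ := Nat.exists_eq_succ_of_ne_zero hk
    rw [Finset.prod_range_succ', Finset.prod_range_succ, add_zero,
      gapType_insertBlock_first hk hm hm0 hp, Nat.succ_sub_one, mul_right_comm]
    congr 2
    refine Finset.prod_congr rfl fun t ht => ?_
    rw [gapType_insertBlock_mid hm hm0 hp (by have := Finset.mem_range.1 ht; omega)]
  rw [wordWeight, length_insertBlock, hq, show p + q + k + 1 = p + (k + 1) + q by omega,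
    Finset.prod_range_add, Finset.prod_range_add, hmid, ← hq, herase, mul_comm (∏ i ∈ _, _),
    mul_assoc]
  congr 2
  · refine Finset.prod_congr rfl fun i hi => ?_
    rw [gapType_insertBlock_left hp (Finset.mem_range.1 hi)]
  · refine Finset.prod_congr rfl fun r hr => ?_
    have := Finset.mem_range.1 hr
    rw [show p + (k + 1) + r = p + k + r + 1 by omega,
      gapType_insertBlock_right hm h0 (by omega)]

end insertBlock

/-! ### Decomposition of Stirling permutations -/

/-- In this form the property visibly passes to subwords, and patterns can be filtered, reversed and
stripped of prefixes. -/
theorem hasStirlingProperty_iff_sublist (σ : List ℕ) :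
    HasStirlingProperty σ ↔ ∀ a b, [a, b, a].Sublist σ → a ≤ b := by
  constructor
  · intro h a b hs
    obtain ⟨is, h1, h2⟩ := List.sublist_eq_map_getElem hs
    obtain ⟨i, s, j, rfl⟩ := List.length_eq_three.1 (by simpa using (congrArg List.length h1).symm)
    simp only [List.map_cons, List.map_nil, List.cons.injEq, and_true] at h1
    simp only [List.pairwise_cons, List.mem_cons, List.not_mem_nil, or_false, forall_eq_or_imp,
      forall_eq] at h2
    have := h i s j h2.1.1 h2.2.1 (h1.1.symm.trans h1.2.2)
    rw [h1.1, h1.2.1]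
    exact this
  · intro h i s j his hsj hij
    refine h _ _ ?_
    have := List.map_getElem_sublist (l := σ) (is := [i, s, j]) (by
      simp [his, hsj, his.trans hsj])
    simp only [List.get_eq_getElem] at hij ⊢
    simpa [hij] using this

theorem HasStirlingProperty.sublist {σ τ : List ℕ} (h : HasStirlingProperty σ)
    (hs : τ.Sublist σ) : HasStirlingProperty τ := by
  rw [hasStirlingProperty_iff_sublist] at h ⊢
  exact fun a b hab => h a b (hab.trans hs)

theorem mem_stirlingPermutations {k n : ℕ} {σ : List ℕ} :
    σ ∈ stirlingPermutations k n ↔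
      (∀ a, σ.count a = if a ∈ Finset.Icc 1 n then k else 0) ∧ HasStirlingProperty σ := by
  have h : ∀ a, (k • (Finset.Icc 1 n).val).count a = if a ∈ Finset.Icc 1 n then k else 0 := by
    intro a
    rw [Multiset.count_nsmul, Multiset.count_eq_of_nodup (Finset.nodup _)]
    simp
  rw [stirlingPermutations, Finset.mem_filter, Multiset.mem_toFinset, Multiset.mem_lists_iff,
    Multiset.quot_mk_to_coe, Multiset.ext]
  simp only [h, Multiset.coe_count, eq_comm]

theorem List.cons_sublist_append_of_notMem {α : Type*} {m : α} {l s r : List α} (hm : m ∉ s)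
    (h : (m :: l).Sublist (s ++ r)) : (m :: l).Sublist r := by
  induction s with
  | nil => exact h
  | cons a s ih =>
    rw [List.mem_cons, not_or] at hm
    rw [List.cons_append] at h
    cases h with
    | cons _ h => exact ih hm.2 h
    | cons_cons _ h => exact absurd rfl hm.1

/-- In a pattern `a b a`, the case `b = m` is harmless since `m` is maximal. If `a = m ≠ b`, then
`b` would lie inside the block. Otherwise the pattern survives deletion of the block and lies in
`σ`. -/
theorem hasStirlingProperty_insertBlock {k m p : ℕ} {σ : List ℕ} (hm : ∀ a ∈ σ, a < m)
    (h : HasStirlingProperty σ) : HasStirlingProperty (insertBlock k m p σ) := by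
  have hmσ : m ∉ σ := fun h => lt_irrefl _ (hm m h)
  have hle : ∀ a ∈ insertBlock k m p σ, a ≤ m := by
    intro a ha
    rw [insertBlock, List.mem_append, List.mem_append] at ha
    rcases ha with ha | ha | ha
    · exact (hm a (List.mem_of_mem_take ha)).le
    · exact (List.eq_of_mem_replicate ha).le
    · exact (hm a (List.mem_of_mem_drop ha)).le
  rw [hasStirlingProperty_iff_sublist] at h ⊢
  intro a b hab
  have ha : a ≤ m := hle a (hab.subset (by simp))
  rcases eq_or_ne b m with rfl | hb
  · exact ha
  rcases eq_or_ne a m with rfl | ha'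
  · have h1 := List.cons_sublist_append_of_notMem (fun h => hmσ (List.mem_of_mem_take h)) hab
    have h2 := h1.reverse
    rw [List.reverse_append, List.reverse_replicate] at h2
    have h3 := List.cons_sublist_append_of_notMem
      (fun h => hmσ (List.mem_of_mem_drop (List.mem_reverse.1 h))) h2
    exact absurd (List.eq_of_mem_replicate (h3.subset (by simp))) hb
  · have h1 := hab.filter (fun c => c ≠ m)
    rw [filter_insertBlock k p hmσ] at h1
    refine h a b ?_
    simpa [ha', hb] using h1

theorem exists_eq_replicate_append {m : ℕ} {r : List ℕ}
    (h : ∀ b, [m, b, m].Sublist (m :: r) → b = m) :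
    ∃ j t, r = List.replicate j m ++ t ∧ m ∉ t := by
  induction r with
  | nil => exact ⟨0, [], rfl, by simp⟩
  | cons c r ih =>
    rcases eq_or_ne c m with rfl | hc
    · obtain ⟨j, t, rfl, ht⟩ := ih fun b hb => h b (hb.trans (List.sublist_cons_self _ _))
      exact ⟨j + 1, t, rfl, ht⟩
    · refine ⟨0, c :: r, rfl, fun hm => ?_⟩
      rcases List.mem_cons.1 hm with hm | hm
      · exact hc hm.symm
      · exact hc (h c (((List.singleton_sublist.2 hm).cons_cons c).cons_cons m))

/-- A letter between two copies of the maximum `m` must be at least `m`, hence equal to `m`; so all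
copies of `m` are adjacent. -/
theorem exists_insertBlock_eq {k m : ℕ} {σ : List ℕ} (hk : k ≠ 0) (hcount : σ.count m = k)
    (hle : ∀ a ∈ σ, a ≤ m) (h : HasStirlingProperty σ) :
    ∃ p ≤ (σ.filter fun a => a ≠ m).length,
      insertBlock k m p (σ.filter fun a => a ≠ m) = σ := by
  have hm : m ∈ σ := List.count_pos_iff.1 (by omega)
  obtain ⟨s, r, rfl, hs⟩ := List.eq_append_cons_of_mem hm
  rw [hasStirlingProperty_iff_sublist] at h
  obtain ⟨j, t, rfl, ht⟩ := exists_eq_replicate_append (m := m) (r := r) fun b hb => by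
    have hb' := hb.trans (List.sublist_append_right s _)
    exact le_antisymm (hle b (hb'.subset (by simp))) (h m b hb')
  have hkj : k = j + 1 := by
    rw [← hcount, List.count_append, List.count_cons_self, List.count_append,
      List.count_eq_zero_of_not_mem hs, List.count_eq_zero_of_not_mem ht,
      List.count_replicate_self]
    omega
  have heq : s ++ m :: (List.replicate j m ++ t) = insertBlock k m s.length (s ++ t) := by
    rw [insertBlock, List.take_left, List.drop_left, hkj, List.replicate_succ, List.cons_append]
  have hst : m ∉ s ++ t := by simp [hs, ht]
  rw [heq, filter_insertBlock _ _ hst]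
  exact ⟨s.length, by simp, rfl⟩

theorem lt_of_mem_stirlingPermutations {k n : ℕ} {σ : List ℕ} (h : σ ∈ stirlingPermutations k n) :
    ∀ a ∈ σ, a < n + 1 := by
  intro a ha
  have h1 := (mem_stirlingPermutations.1 h).1 a
  have h2 := List.count_pos_iff.2 ha
  split_ifs at h1 with h3
  · have := Finset.mem_Icc.1 h3
    omega
  · omega

theorem zero_notMem_of_mem_stirlingPermutations {k n : ℕ} {σ : List ℕ}
    (h : σ ∈ stirlingPermutations k n) : 0 ∉ σ := by
  rw [← List.count_eq_zero, (mem_stirlingPermutations.1 h).1]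
  simp

theorem insertBlock_mem_stirlingPermutations {k n : ℕ} {σ : List ℕ} (p : ℕ)
    (h : σ ∈ stirlingPermutations k n) :
    insertBlock k (n + 1) p σ ∈ stirlingPermutations k (n + 1) := by
  have hlt := lt_of_mem_stirlingPermutations h
  rw [mem_stirlingPermutations] at h ⊢
  refine ⟨fun a => ?_, hasStirlingProperty_insertBlock hlt h.2⟩
  rw [count_insertBlock, h.1]
  simp only [Finset.mem_Icc]
  split_ifs <;> omega

theorem filter_mem_stirlingPermutations {k n : ℕ} {σ : List ℕ}
    (h : σ ∈ stirlingPermutations k (n + 1)) :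
    (σ.filter fun a => a ≠ n + 1) ∈ stirlingPermutations k n := by
  rw [mem_stirlingPermutations] at h ⊢
  refine ⟨fun a => ?_, h.2.sublist List.filter_sublist⟩
  rcases eq_or_ne a (n + 1) with rfl | ha
  · rw [List.count_eq_zero_of_not_mem (by simp)]
    simp
  · rw [List.count_filter (by simpa using ha), h.1]
    simp only [Finset.mem_Icc]
    split_ifs <;> omega

theorem sum_stirlingPermutations_succ {k : ℕ} (hk : k ≠ 0) (n : ℕ) {M : Type*} [AddCommMonoid M]
    (f : List ℕ → M) :
    ∑ σ ∈ stirlingPermutations k (n + 1), f σ =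
      ∑ σ ∈ stirlingPermutations k n, ∑ p ∈ Finset.range (σ.length + 1),
        f (insertBlock k (n + 1) p σ) := by
  rw [Finset.sum_sigma']
  symm
  refine Finset.sum_bij (fun x _ => insertBlock k (n + 1) x.2 x.1) ?_ ?_ ?_ ?_
  · rintro ⟨σ, p⟩ h
    exact insertBlock_mem_stirlingPermutations p (Finset.mem_sigma.1 h).1
  · rintro ⟨σ, p⟩ h ⟨τ, q⟩ h' heq
    simp only [Finset.mem_sigma, Finset.mem_range, Nat.lt_succ_iff] at h h' heq
    have hσ : n + 1 ∉ σ := fun hm => lt_irrefl _ (lt_of_mem_stirlingPermutations h.1 _ hm)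
    have hτ : n + 1 ∉ τ := fun hm => lt_irrefl _ (lt_of_mem_stirlingPermutations h'.1 _ hm)
    have h1 : σ = τ := by
      rw [← filter_insertBlock k p hσ, heq, filter_insertBlock k q hτ]
    have h2 : p = q := by
      rw [← idxOf_insertBlock hk hσ h.2, heq, idxOf_insertBlock hk hτ h'.2]
    rw [h1, h2]
  · intro σ h
    have hmem := mem_stirlingPermutations.1 h
    obtain ⟨p, hp, hpe⟩ := exists_insertBlock_eq (m := n + 1) hk (by rw [hmem.1]; simp)
      (fun a ha => Nat.lt_succ_iff.1 (lt_of_mem_stirlingPermutations h a ha)) hmem.2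
    exact ⟨⟨_, p⟩, Finset.mem_sigma.2 ⟨filter_mem_stirlingPermutations h,
      Finset.mem_range.2 (Nat.lt_succ_iff.2 hp)⟩, hpe⟩
  · intros
    rfl

theorem stirlingPermutations_zero (k : ℕ) : stirlingPermutations k 0 = {[]} := by
  ext σ
  rw [mem_stirlingPermutations, Finset.mem_singleton]
  constructor
  · rintro ⟨h, -⟩
    refine List.eq_nil_iff_forall_not_mem.2 fun a => ?_
    rw [← List.count_eq_zero, h]
    simp
  · rintro rfl
    exact ⟨by simp, fun i => i.elim0⟩

/-! ### The recursion for the Eulerian polynomials -/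

/-- The variables, extended periodically to a sequence. -/
noncomputable def variableSeq (k j : ℕ) : MvPolynomial (Fin (k + 1)) ℤ :=
  MvPolynomial.X (Fin.ofNat (k + 1) j)

theorem prod_variableSeq (k : ℕ) :
    ∏ j ∈ Finset.range (k + 1), variableSeq k j = coesymm k 0 := by
  rw [coesymm_zero, Finset.prod_range]
  refine Finset.prod_congr rfl fun j _ => ?_
  simp [variableSeq]

theorem eulerianPoly_eq_sum_wordWeight {k n : ℕ} (hk : k ≠ 0) (hn : n ≠ 0) :
    eulerianPoly k n = ∑ σ ∈ stirlingPermutations k n, wordWeight (variableSeq k) k σ := by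
  refine Finset.sum_congr rfl fun σ h => ?_
  have hc := (mem_stirlingPermutations.1 h).1
  have hne : σ ≠ [] := by
    rintro rfl
    have := hc 1
    rw [if_pos (by rw [Finset.mem_Icc]; omega), List.count_nil] at this
    exact hk this.symm
  rw [← prod_pow_weightExponent (variableSeq k) hk (zero_notMem_of_mem_stirlingPermutations h) hne
    fun a => by rw [hc]; split_ifs <;> omega, Finset.prod_range]
  refine Finset.prod_congr rfl fun j _ => ?_
  simp [variableSeq]

/-- By the Leibniz rule, `D` of a word's weight is the sum over its gaps of the weight with that
gap's variable deleted, which is the effect of inserting a block there up to the factor `coesymm k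
0`. -/
theorem eulerianPoly_succ {k n : ℕ} (hk : k ≠ 0) (hn : n ≠ 0) :
    eulerianPoly k (n + 1) = coesymm k 0 * sumPartials (Fin (k + 1)) (eulerianPoly k n) := by
  rw [eulerianPoly_eq_sum_wordWeight hk n.succ_ne_zero, sum_stirlingPermutations_succ hk,
    eulerianPoly_eq_sum_wordWeight hk hn, map_sum, Finset.mul_sum]
  refine Finset.sum_congr rfl fun σ h => ?_
  rw [wordWeight, derivation_map_prod, Finset.mul_sum]
  refine Finset.sum_congr rfl fun p hp => ?_
  rw [wordWeight_insertBlock _ hk (lt_of_mem_stirlingPermutations h)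
    (zero_notMem_of_mem_stirlingPermutations h) n.succ_pos
    (Nat.lt_succ_iff.1 (Finset.mem_range.1 hp)), prod_variableSeq]
  congr 1
  simp [variableSeq]

theorem eulerianPoly_one {k : ℕ} (hk : k ≠ 0) : eulerianPoly k 1 = coesymm k 0 := by
  have h := sum_stirlingPermutations_succ hk 0 (wordWeight (variableSeq k) k)
  rw [zero_add] at h
  rw [eulerianPoly_eq_sum_wordWeight hk one_ne_zero, h, stirlingPermutations_zero]
  simp [wordWeight_insertBlock (σ := []) (m := 1) _ hk, prod_variableSeq]

theorem eulerianPoly_eq_genPoly {k n : ℕ} (hk : k ≠ 0) (hn : n ≠ 0) :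
    eulerianPoly k n = IncreasingPlaneTree.genPoly (coesymm k) n := by
  induction n with
  | zero => exact absurd rfl hn
  | succ n ih =>
    rcases eq_or_ne n 0 with rfl | hn'
    · rw [eulerianPoly_one hk, IncreasingPlaneTree.genPoly_one]
    · rw [eulerianPoly_succ hk hn', ih hn', IncreasingPlaneTree.genPoly_succ
        (sumPartials (Fin (k + 1))) _ (sumPartials_coesymm k) hn']

/-! ### Degree sequences of increasing plane trees -/

namespace IncreasingPlaneTree

/-- The number of vertices of each degree. -/
def degreeCount {n : ℕ} (T : IncreasingPlaneTree n) (j : Fin n) : ℕ :=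
  (Finset.univ.filter fun v => T.degree v = (j : ℕ)).card

theorem toFinset_children_subset {n : ℕ} (T : IncreasingPlaneTree n) (v : Fin n) :
    (T.children v).toFinset ⊆ Finset.Ioi v := fun u hu =>
  Finset.mem_Ioi.2 (T.lt_of_mem v u (List.mem_toFinset.1 hu))

theorem card_toFinset_children {n : ℕ} (T : IncreasingPlaneTree n) (v : Fin n) :
    (T.children v).toFinset.card = T.degree v :=
  List.toFinset_card_of_nodup (T.children_nodup v)

theorem degree_le {n : ℕ} (T : IncreasingPlaneTree n) (v : Fin n) : T.degree v ≤ n - 1 - v := by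
  rw [← card_toFinset_children, ← Fin.card_Ioi]
  exact Finset.card_le_card (T.toFinset_children_subset v)

theorem degree_lt {n : ℕ} (T : IncreasingPlaneTree n) (v : Fin n) : T.degree v < n := by
  have := T.degree_le v
  have := v.isLt
  omega

theorem sum_degreeCount {n : ℕ} (T : IncreasingPlaneTree n) : ∑ j, T.degreeCount j = n := by
  have h := Finset.card_eq_sum_card_fiberwise (s := (Finset.univ : Finset (Fin n)))
    (t := (Finset.univ : Finset (Fin n))) (f := fun v => (⟨T.degree v, T.degree_lt v⟩ : Fin n))
    (by simp [Set.MapsTo])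
  rw [Finset.card_univ, Fintype.card_fin] at h
  simpa [degreeCount, Fin.ext_iff] using h.symm

/-- A root of degree `n - 1` is the parent of every other vertex, leaving no children for anyone
else. -/
theorem degree_eq_zero_of_degree_zero {n : ℕ} (hn : 0 < n) (T : IncreasingPlaneTree n)
    (h : T.degree ⟨0, hn⟩ = n - 1) (v : Fin n) (hv : v ≠ ⟨0, hn⟩) : T.degree v = 0 := by
  have heq : (T.children ⟨0, hn⟩).toFinset = Finset.Ioi ⟨0, hn⟩ := by
    refine Finset.eq_of_subset_of_card_le (T.toFinset_children_subset _) ?_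
    rw [card_toFinset_children, h, Fin.card_Ioi]
    exact Nat.sub_le _ _
  rw [degree, List.length_eq_zero_iff, List.eq_nil_iff_forall_not_mem]
  intro u hu
  refine hv (T.eq_of_mem_children hu ?_)
  rw [← List.mem_toFinset, heq, Finset.mem_Ioi, Fin.lt_def]
  exact lt_of_le_of_lt (Nat.zero_le _) (T.lt_of_mem v u hu)

/-- The vertex `n` is a leaf and, as `n ≥ 2`, the root is not. Only the root has enough larger
labels to reach degree `n - 1`, and then all other vertices are leaves. -/
theorem degreeCount_mem_indexSequences {n : ℕ} (hn : 2 ≤ n) (T : IncreasingPlaneTree n) :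
    T.degreeCount ∈ indexSequences n hn := by
  have hroot : T.degree ⟨0, by omega⟩ ≠ 0 := by
    -- The vertex labelled `2` can only be a child of the root.
    obtain ⟨v, hv⟩ := T.exists_mem_children ⟨1, by omega⟩ one_ne_zero
    have hlt := Fin.lt_def.1 (T.lt_of_mem v _ hv)
    have hv0 : v = ⟨0, by omega⟩ := Fin.ext (Nat.lt_one_iff.1 hlt)
    rw [hv0] at hv
    exact (List.length_pos_of_mem hv).ne'
  have hcard : ((Finset.univ : Finset (Fin n)).erase ⟨0, by omega⟩).card = n - 1 := by
    simp
  have hle : T.degreeCount ⟨0, by omega⟩ ≤ n - 1 := by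
    rw [← hcard]
    refine Finset.card_le_card fun v hv => ?_
    rw [Finset.mem_erase]
    refine ⟨?_, Finset.mem_univ v⟩
    rintro rfl
    exact hroot (Finset.mem_filter.1 hv).2
  have hsub : (Finset.univ.filter fun v => T.degree v = n - 1) ⊆ {⟨0, by omega⟩} := by
    intro v hv
    have h1 := T.degree_le v
    rw [(Finset.mem_filter.1 hv).2] at h1
    rw [Finset.mem_singleton]
    ext
    change (v : ℕ) = 0
    omega
  rw [indexSequences, Finset.mem_filter, Finset.mem_piAntidiag]
  refine ⟨⟨T.sum_degreeCount, fun _ _ => Finset.mem_univ _⟩, ⟨?_, hle⟩, ?_, ?_⟩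
  · refine Finset.card_pos.2 ⟨⟨n - 1, by omega⟩, ?_⟩
    simpa using T.degree_le ⟨n - 1, by omega⟩
  · have := Finset.card_le_card hsub
    rw [Finset.card_singleton] at this
    exact Nat.le_one_iff_eq_zero_or_eq_one.1 this
  · intro h
    have hdeg : T.degree ⟨0, by omega⟩ = n - 1 := by
      have h1 := Finset.eq_of_subset_of_card_le hsub (by rw [Finset.card_singleton]; exact h.ge)
      have h2 := Finset.mem_singleton_self (⟨0, by omega⟩ : Fin n)
      rw [← h1] at h2
      exact (Finset.mem_filter.1 h2).2
    refine le_antisymm hle ?_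
    rw [← hcard]
    refine Finset.card_le_card fun v hv => ?_
    simpa using T.degree_eq_zero_of_degree_zero _ hdeg v (Finset.ne_of_mem_erase hv)

theorem prod_degree {R : Type*} [CommRing R] (y : ℕ → R) {n : ℕ} (T : IncreasingPlaneTree n) :
    ∏ v, y (T.degree v) = ∏ j : Fin n, y j ^ T.degreeCount j := by
  rw [← Finset.prod_fiberwise_of_maps_to (s := Finset.univ) (t := Finset.univ)
    (g := fun v => (⟨T.degree v, T.degree_lt v⟩ : Fin n)) (by simp)]
  refine Finset.prod_congr rfl fun j _ => ?_
  simp only [degreeCount, Fin.ext_iff]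
  rw [← Finset.prod_const]
  refine Finset.prod_congr rfl fun v hv => ?_
  rw [(Finset.mem_filter.1 hv).2]

/-- Every degree is at most `n - 1 ≤ d`, so the bound `d` imposes nothing; this makes the count the
same for all admissible `d`. -/
theorem treeCount_eq_card {d n : ℕ} (hd : n ≤ d + 1) (i : Fin n → ℕ) :
    treeCount d n i =
      (Finset.univ.filter fun T : IncreasingPlaneTree n => T.degreeCount = i).card := by
  rw [treeCount, ← Nat.subtype_card (p := fun T : IncreasingPlaneTree n =>
    (∀ v, T.degree v ≤ d) ∧
      ∀ j : Fin n, (Finset.univ.filter fun v => T.degree v = (j : ℕ)).card = i j)]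
  intro T
  rw [Finset.mem_filter]
  constructor
  · rintro ⟨-, rfl⟩
    refine ⟨fun v => ?_, fun j => rfl⟩
    have := T.degree_lt v
    omega
  · exact fun h => ⟨Finset.mem_univ T, funext h.2⟩

theorem genPoly_eq_sum_treeCount {R : Type*} [CommRing R] (y : ℕ → R) {n : ℕ} (hn : 2 ≤ n) :
    genPoly y n = ∑ i ∈ indexSequences n hn, (treeCount n n i : R) * ∏ j : Fin n, y j ^ i j := by
  rw [genPoly, ← Finset.sum_fiberwise_of_maps_to
    fun T _ => degreeCount_mem_indexSequences hn T]
  refine Finset.sum_congr rfl fun i _ => ?_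
  rw [treeCount_eq_card n.le_succ, ← nsmul_eq_mul, ← Finset.sum_const]
  refine Finset.sum_congr rfl fun T hT => ?_
  rw [prod_degree, (Finset.mem_filter.1 hT).2]

end IncreasingPlaneTree

/-- For `j : Fin n` the factor `e_{k+1-j}` is raised to the power `i_{j+1}`; since `j ≤ n - 1 ≤ k + 1`
the subtraction is never truncated. The coefficients depend only on `n` and the sequence. -/
theorem mainTheorem1 (n : ℕ) (hn : 2 ≤ n) :
    ∃ γ : (Fin n → ℕ) → ℕ, ∀ k : ℕ, 1 ≤ k → n ≤ k + 2 →
      eulerianPoly k n =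
          ∑ i ∈ indexSequences n hn,
            (γ i : MvPolynomial (Fin (k + 1)) ℤ) *
              ∏ j : Fin n, MvPolynomial.esymm (Fin (k + 1)) ℤ (k + 1 - (j : ℕ)) ^ i j ∧
        ∀ i ∈ indexSequences n hn, γ i = treeCount (k + 1) n i := by
  -- The degree bound `n` is never attained, so it serves as a vacuous bound that does not mention
  -- `k`.
  refine ⟨treeCount n n, fun k hk hnk => ⟨?_, fun i _ => ?_⟩⟩
  · rw [eulerianPoly_eq_genPoly (by omega) (by omega),
      IncreasingPlaneTree.genPoly_eq_sum_treeCount _ hn]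
    refine Finset.sum_congr rfl fun i _ => ?_
    congr 1
    refine Finset.prod_congr rfl fun j _ => ?_
    rw [coesymm, if_pos (by omega)]
  · rw [IncreasingPlaneTree.treeCount_eq_card n.le_succ,
      IncreasingPlaneTree.treeCount_eq_card hnk]
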